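/- Let $\mathcal B\subseteq\mathbb R^3$ be an elastic body, i.e. an open subset of $\mathbb R^3$ (the body is identified with its image under a reference configuration) with a smooth response functional $W: Gl(3,\mathbb R)\times\mathcal B\to V$, $V$ a real normed space. A 1-jet $j^1_{x,y}\psi$ of a local diffeomorphism of $\mathcal B$ is *material* if $W(j^1_y\kappa\cdot j^1_{x,y}\psi)=W(j^1_y\kappa)$ for all infinitesimal deformations $j^1_y\kappa$ at $y$, i.e. $W(F\cdot T_x\psi,x)=W(F,y)$ for all $F\in Gl(3,\mathbb R)$. The material 1-jets form the material groupoid $\Omega(\mathcal B)\rightrightarrows\mathcal B$, with isotropy group $G(z)$ at $z$; $\mathcal B$ is *uniform* if there is a material 1-jet from $x$ to $y$ for all $x,y\in\mathcal B$. Fix $z_0\in\mathcal B$ and a linear frame $Z_0$ at $z_0$ (a reference crystal), and put $$G_0=Z_0^{-1}\cdot G(z_0)\cdot Z_0,\qquad \omega_{G_0}(\mathcal B)=\{L\cdot Z_0\cdot g\ :\ L\in\Omega(\mathcal B)\text{ with source } z_0,\ g\in G_0\}.$$ For a set $\omega$ of frames let $\mathcal G(\omega)=\{L_y\cdot L_x^{-1}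 : L_x,L_y\in\omega\}$. Terminology. Lie subgroups of $Gl(3,\mathbb R)$ are closed subgroups; $\tau_v$ is translation by $v$; a deformation of an open set $U\subseteq\mathcal B$ is a diffeomorphism $\kappa$ of $U$ onto an open subset of $\mathbb R^3$. * $\omega_{G_0}(\mathcal B)$ is *integrable* if around each point there is a chart $\varphi:U\to\overline U$ of $\mathcal B$ such that $(x,Z)\mapsto(\varphi(x),T_x\varphi\circ Z)$ is a diffeomorphism from the part of $\omega_{G_0}(\mathcal B)$ over $U$ onto $\overline U\times G_0$. * $\Omega(\mathcal B)$ is *integrable* if there is a Lie subgroup $G$ of $Gl(3,\mathbb R)$ such that for all $x_0,y_0\in\mathcal B$ there are charts $\psi_U:U\to\overline U$ around $x_0$ and $\psi_V:V\to\overline V$ around $y_0$ for which $$j^1_{x,y}\phi\mapsto\bigl(\psi_U(x),\psi_V(y),j^1_{0,0}(\tau_{-\psi_V(y)}\circ\psi_V\circ\phi\circ\psi_U^{-1}\circ\tau_{\psi_U(x)})\bigr)$$ is a diffeomorphism from the set of elements of $\Omega(\mathcal B)$ with source in $U$ and target in $V$ onto $\overline U\times\overline V\times G$. * An open $U\subseteq\mathcal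 B$ is *homogeneous in the groupoid sense* if it has a deformation $\kappa$ with $j^1_{x,y}(\kappa^{-1}\circ\tau_{\kappa(y)-\kappa(x)}\circ\kappa)\in\Omega(\mathcal B)$ for all $x,y\in U$, and *homogeneous in the $G$-structure sense* (with respect to $Z_0$) if it has a deformation $\kappa$ with $j^1_{0,x}(\kappa^{-1}\circ\tau_{\kappa(x)})\in\omega_{G_0}(\mathcal B)$ for all $x\in U$. In either sense, $\mathcal B$ is *locally homogeneous* if it is covered by homogeneous open sets. **Theorem.** Let $\mathcal B$ be uniform, $z_0\in\mathcal B$, and $Z_0$ a frame at $z_0$. 1. If $\sigma_a:U_a\to\Omega_{z_0}(\mathcal B)$ are smooth local sections, over open sets covering $\mathcal B$, of the target map on the set $\Omega_{z_0}(\mathcal B)$ of elements of $\Omega(\mathcal B)$ with source $z_0$, then $\omega_{G_0}(\mathcal B)$ is a $G_0$-structure on $\mathcal B$, and its fibre over each $x\in U_a$ is $\sigma_a(x)\cdot Z_0\cdot G_0$. 2. $\mathcal G(\omega_{G_0}(\mathcal B))=\Omega(\mathcal B)$. 3. $\omega_{G_0}(\mathcal B)$ is integrable if and only if $\Omega(\mathcal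 B)$ is integrable. 4. $\mathcal B$ is homogeneous in the groupoid sense if and only if it is homogeneous in the $G$-structure sense with respect to $Z_0$; the same holds for local homogeneity. 5. $\mathcal B$ is locally homogeneous in the groupoid sense if and only if $\Omega(\mathcal B)$ is integrable. -/

import Mathlib

open scoped ContDiff

/-- The space `ℝ³`. -/
abbrev E3 : Type := EuclideanSpace ℝ (Fin 3)

/-- The linear endomorphisms of `ℝ³`. -/
abbrev End3 : Type := E3 →L[ℝ] E3

/-- `Gl(3, ℝ)`, the linear isomorphisms of `ℝ³`; multiplication is composition. -/
abbrev GL3 : Type := End3ˣ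

/-! ### Smooth maps between subsets, local diffeomorphisms -/

section Smooth

variable {X Y : Type*} [NormedAddCommGroup X] [NormedSpace ℝ X]
  [NormedAddCommGroup Y] [NormedSpace ℝ Y]

/-- `f` is smooth on the (not necessarily open) subset `S`: around every point of `S` it is the
restriction of a smooth map defined on an open set of the ambient space. -/
def SmoothOnSubset (f : X → Y) (S : Set X) : Prop :=
  ∀ p ∈ S, ∃ U : Set X, IsOpen U ∧ p ∈ U ∧
    ∃ F : X → Y, ContDiffOn ℝ ∞ F U ∧ Set.EqOn F f (S ∩ U)

/-- `f` restricts to a diffeomorphism from the subset `S` onto the subset `T`. -/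
def IsDiffeoOn (f : X → Y) (S : Set X) (T : Set Y) : Prop :=
  Set.BijOn f S T ∧ SmoothOnSubset f S ∧
    ∃ g : Y → X, (∀ p ∈ S, g (f p) = p) ∧ SmoothOnSubset g T

end Smooth

/-- A homeomorphism between open subsets of `ℝ³` is a diffeomorphism. -/
def IsSmoothLocal (ψ : OpenPartialHomeomorph E3 E3) : Prop :=
  ContDiffOn ℝ ∞ ψ ψ.source ∧ ContDiffOn ℝ ∞ ψ.symm ψ.target

/-- `P` is (the linear part of) the 1-jet `j¹_{x,y} ψ`: `ψ x = y` and `T_x ψ = P`. -/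
def IsJet (ψ : E3 → E3) (x y : E3) (P : GL3) : Prop :=
  ψ x = y ∧ HasFDerivAt ψ (P : End3) x

/-! ### Frames and 1-jets over an open subset of `ℝ³`

A linear frame at `x` is a linear isomorphism `Z : ℝ³ → T_x = ℝ³`, and is written `(x, Z)`. An
element of the 1-jets groupoid from `x` to `y` is a linear isomorphism `P : T_x → T_y`, and is
written `(x, y, P)`; its source is `x`, its target is `y`, and
`(y, z, Q) · (x, y, P) = (x, z, Q * P)`. Sets of frames are regarded inside the normed space
`ℝ³ × End(ℝ³)`, sets of 1-jets inside `ℝ³ × ℝ³ × End(ℝ³)`. -/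

/-- The part of a set `R` of frames that lies over `U`, inside `ℝ³ × End(ℝ³)`. -/
def framesOver (R : Set (E3 × GL3)) (U : Set E3) : Set (E3 × End3) :=
  {q | ∃ x Z, (x, Z) ∈ R ∧ x ∈ U ∧ q = (x, (Z : End3))}

/-- The part `Γ(U, V)` of a set `Γ` of 1-jets with source in `U` and target in `V`, inside
`ℝ³ × ℝ³ × End(ℝ³)`. -/
def jetsOver (Γ : Set (E3 × E3 × GL3)) (U V : Set E3) : Set (E3 × E3 × End3) :=
  {q | ∃ x y P, (x, y, P) ∈ Γ ∧ x ∈ U ∧ y ∈ V ∧ q = (x, y, (P : End3))}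

/-- The matrices of a subgroup of `Gl(3, ℝ)`. -/
def matrices (G : Subgroup GL3) : Set End3 := (fun g : GL3 => (g : End3)) '' (G : Set GL3)

/-- The map induced by a chart `ψ` on frames, `(x, Z) ↦ (ψ(x), T_x ψ ∘ Z)`. -/
noncomputable def frameChart (ψ : OpenPartialHomeomorph E3 E3) (q : E3 × End3) : E3 × End3 :=
  (ψ q.1, (fderiv ℝ ψ q.1).comp q.2)

/-- The map induced by two charts on 1-jets,
`j¹_{x,y} ϕ ↦ (ψ_U(x), ψ_V(y), j¹_{0,0} (τ_{-ψ_V(y)} ∘ ψ_V ∘ ϕ ∘ ψ_U⁻¹ ∘ τ_{ψ_U(x)}))`. -/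
noncomputable def jetChart (ψU ψV : OpenPartialHomeomorph E3 E3) (q : E3 × E3 × End3) :
    E3 × E3 × End3 :=
  (ψU q.1, ψV q.2.1,
    ((fderiv ℝ ψV q.2.1).comp q.2.2).comp (fderiv ℝ ψU.symm (ψU q.1)))

/-! ### G-structures and subgroupoids of the 1-jets groupoid -/

/-- `R` is a `G`-structure on the open set `B`: a reduced subbundle of the frame bundle of `B`
whose structure group is the Lie subgroup (that is, the closed subgroup) `G` of `Gl(3, ℝ)`. -/
structure IsGStructure (B : Set E3) (G : Subgroup GL3) (R : Set (E3 × GL3)) : Prop where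
  isClosed : IsClosed (G : Set GL3)
  base : ∀ x Z, (x, Z) ∈ R → x ∈ B
  locally_trivial : ∀ x ∈ B, ∃ U : Set E3, IsOpen U ∧ x ∈ U ∧ U ⊆ B ∧
    ∃ S : E3 → GL3, ContDiffOn ℝ ∞ (fun y => (S y : End3)) U ∧
      ∀ y ∈ U, ∀ Z, (y, Z) ∈ R ↔ ∃ g ∈ G, Z = S y * g

/-- A `G`-structure `R` on `B` is integrable: around every point there is a chart of `B` that
carries `R` onto the restriction of the standard flat `G`-structure `ℝ³ × G`. -/
def IsIntegrableGStructure (B : Set E3) (G : Subgroup GL3) (R : Set (E3 × GL3)) : Prop :=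
  ∀ x ∈ B, ∃ φ : OpenPartialHomeomorph E3 E3,
    IsSmoothLocal φ ∧ φ.source ⊆ B ∧ x ∈ φ.source ∧
      IsDiffeoOn (frameChart φ) (framesOver R φ.source) (φ.target ×ˢ matrices G)

/-- A subgroupoid `Γ` of the 1-jets groupoid of `B` is integrable: for some Lie subgroup (closed
subgroup) `G` of `Gl(3, ℝ)` it is locally diffeomorphic, through charts `ψ_U`, `ψ_V` of `B` around
any two given points, to the standard flat groupoid `ℝ³ × ℝ³ × G`. -/
def IsIntegrableGroupoid (B : Set E3) (Γ : Set (E3 × E3 × GL3)) : Prop :=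
  ∃ G : Subgroup GL3, IsClosed (G : Set GL3) ∧
    ∀ x ∈ B, ∀ y ∈ B, ∃ ψU ψV : OpenPartialHomeomorph E3 E3,
      IsSmoothLocal ψU ∧ ψU.source ⊆ B ∧ x ∈ ψU.source ∧
      IsSmoothLocal ψV ∧ ψV.source ⊆ B ∧ y ∈ ψV.source ∧
        IsDiffeoOn (jetChart ψU ψV) (jetsOver Γ ψU.source ψV.source)
          (ψU.target ×ˢ ψV.target ×ˢ matrices G)

/-- The map `𝒢`: it sends a set of frames `R` to the set of all `L_y · L_x⁻¹` with
`L_x, L_y ∈ R`. -/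
def frameQuotients (R : Set (E3 × GL3)) : Set (E3 × E3 × GL3) :=
  {q | ∃ x y Lx Ly, (x, Lx) ∈ R ∧ (y, Ly) ∈ R ∧ q = (x, y, Ly * Lx⁻¹)}

/-! ### Elastic bodies -/

/-- An elastic body, identified with its image under a reference configuration: an open subset of
`ℝ³`, with a smooth response functional `W : Gl(3, ℝ) × B → V`. The value `W A x` matters only for
invertible `A` and `x ∈ B`. -/
structure ElasticBody (V : Type*) [NormedAddCommGroup V] [NormedSpace ℝ V] where
  carrier : Set E3
  isOpen_carrier : IsOpen carrier
  W : End3 → E3 → V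
  smooth_W : ContDiffOn ℝ ∞ (fun p : End3 × E3 => W p.1 p.2) {p | IsUnit p.1 ∧ p.2 ∈ carrier}

namespace ElasticBody

variable {V : Type*} [NormedAddCommGroup V] [NormedSpace ℝ V] (𝓑 : ElasticBody V)

/-- The 1-jet `(x, y, P)` is material: `W (j¹_y κ · P) = W (j¹_y κ)` for all infinitesimal
deformations `F = j¹_y κ` at `y`; these are exactly the linear isomorphisms. -/
def IsMaterial (x y : E3) (P : GL3) : Prop :=
  ∀ F : GL3, 𝓑.W ((F * P : GL3) : End3) x = 𝓑.W (F : End3) y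

/-- The body is uniform: any two of its points are related by a material local diffeomorphism. -/
def IsUniform : Prop :=
  ∀ x ∈ 𝓑.carrier, ∀ y ∈ 𝓑.carrier, ∃ ψ : OpenPartialHomeomorph E3 E3,
    IsSmoothLocal ψ ∧ ψ.source ⊆ 𝓑.carrier ∧ ψ.target ⊆ 𝓑.carrier ∧ x ∈ ψ.source ∧
      ∃ P : GL3, IsJet ψ x y P ∧ 𝓑.IsMaterial x y P

/-- The material groupoid `Ω(B)`. Every linear isomorphism `T_x B → T_y B` is the 1-jet of a local
diffeomorphism of `B`, so that all the material isomorphisms belong to it. -/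
def materialGroupoid : Set (E3 × E3 × GL3) :=
  {q | q.1 ∈ 𝓑.carrier ∧ q.2.1 ∈ 𝓑.carrier ∧ 𝓑.IsMaterial q.1 q.2.1 q.2.2}

/-- The group `G(z)` of material symmetries at `z`. -/
def symmetryGroup (z : E3) : Subgroup GL3 where
  carrier := {P | 𝓑.IsMaterial z z P}
  one_mem' := fun F => by simp
  mul_mem' := fun {P Q} hP hQ F => by
    rw [← mul_assoc]
    exact (hQ (F * P)).trans (hP F)
  inv_mem' := fun {P} hP F => by
    have h := hP (F * P⁻¹)
    rw [inv_mul_cancel_right] at h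
    exact h.symm

/-- The isotropy group `G₀ = Z₀⁻¹ · G(z₀) · Z₀` of the body with respect to the frame `Z₀` at
`z₀`. -/
def isotropyGroup (z₀ : E3) (Z₀ : GL3) : Subgroup GL3 :=
  (𝓑.symmetryGroup z₀).map (MulAut.conj Z₀⁻¹).toMonoidHom

/-- The `G₀`-structure `ω_{G₀}(B)` built from the material groupoid and the reference crystal `Z₀`
at `z₀`: the frames `L · Z₀ · g` with `L ∈ Ω(B)` of source `z₀` and `g ∈ G₀`. -/
def gStructure (z₀ : E3) (Z₀ : GL3) : Set (E3 × GL3) :=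
  {q | ∃ x L g, (z₀, x, L) ∈ 𝓑.materialGroupoid ∧ g ∈ 𝓑.isotropyGroup z₀ Z₀ ∧
    q = (x, L * Z₀ * g)}

/-- A family of smooth local sections `σ a : U a → Ω_{z₀}(B)`, whose domains cover `B`. -/
structure IsSectionFamily {ι : Type*} (z₀ : E3) (U : ι → Set E3) (σ : ι → E3 → GL3) : Prop where
  isOpen : ∀ a, IsOpen (U a)
  cover : ⋃ a, U a = 𝓑.carrier
  smooth : ∀ a, ContDiffOn ℝ ∞ (fun x => (σ a x : End3)) (U a)
  mem : ∀ a, ∀ x ∈ U a, (z₀, x, σ a x) ∈ 𝓑.materialGroupoid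

/-- The open part `U` of the body is homogeneous in the groupoid sense: it has a deformation `κ`
such that `j¹_{x,y} (κ⁻¹ ∘ τ_{κ(y) - κ(x)} ∘ κ)` is material for all `x, y ∈ U`. -/
def IsHomogeneousOn (U : Set E3) : Prop :=
  ∃ κ : OpenPartialHomeomorph E3 E3, IsSmoothLocal κ ∧ κ.source = U ∧
    ∀ x ∈ U, ∀ y ∈ U, ∃ P : GL3, (x, y, P) ∈ 𝓑.materialGroupoid ∧
      IsJet (fun z => κ.symm (κ z + (κ y - κ x))) x y P

/-- Homogeneity in the groupoid sense. -/
def IsHomogeneous : Prop := 𝓑.IsHomogeneousOn 𝓑.carrier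

/-- Local homogeneity in the groupoid sense. -/
def IsLocallyHomogeneous : Prop :=
  ∀ x ∈ 𝓑.carrier, ∃ U : Set E3, IsOpen U ∧ U ⊆ 𝓑.carrier ∧ x ∈ U ∧ 𝓑.IsHomogeneousOn U

/-- The open part `U` of the body is homogeneous with respect to the frame `Z₀` at `z₀`: it has a
deformation `κ` such that `x ↦ j¹_{0,x} (κ⁻¹ ∘ τ_{κ(x)})` is a uniform reference, that is, a section
of `ω_{G₀}(B)`, over `U`. -/
def IsFrameHomogeneousOn (z₀ : E3) (Z₀ : GL3) (U : Set E3) : Prop :=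
  ∃ κ : OpenPartialHomeomorph E3 E3, IsSmoothLocal κ ∧ κ.source = U ∧
    ∀ x ∈ U, ∃ Z : GL3, (x, Z) ∈ 𝓑.gStructure z₀ Z₀ ∧
      IsJet (fun v => κ.symm (v + κ x)) 0 x Z

/-- Homogeneity in the sense of `G`-structures. -/
def IsFrameHomogeneous (z₀ : E3) (Z₀ : GL3) : Prop :=
  𝓑.IsFrameHomogeneousOn z₀ Z₀ 𝓑.carrier

/-- Local homogeneity in the sense of `G`-structures. -/
def IsFrameLocallyHomogeneous (z₀ : E3) (Z₀ : GL3) : Prop :=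
  ∀ x ∈ 𝓑.carrier, ∃ U : Set E3, IsOpen U ∧ U ⊆ 𝓑.carrier ∧ x ∈ U ∧
    𝓑.IsFrameHomogeneousOn z₀ Z₀ U

end ElasticBody

/-! A choice of frames turns every notion into a statement about cosets of `G₀`. A frame `Z` at `x`
lies in `ω_{G₀}(B)` exactly when `Z * Z₀⁻¹` is material from `z₀` to `x`; hence its fibres are left
cosets of `G₀`, and for `X`, `Y` in the structure over `x`, `y`, a jet `P` is material exactly when
`Y⁻¹ * P * X ∈ G₀` (`mem_materialGroupoid_iff_of_mem`).

On the differential side, a chart flattens a set of frames or jets precisely when membership, read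
through tangent maps, is membership in the group (`isDiffeoOn_frameChart_iff`,
`isDiffeoOn_jetChart_iff`); smoothness is automatic because the induced maps and their inverses are
smooth on open sets.

So integrability of `ω_{G₀}(B)` and frame homogeneity both ask that the inverse tangent maps of a
chart lie in `ω_{G₀}(B)`, while groupoid homogeneity asks this only of quotients of tangent maps.
The gap is one constant linear map, which uniformity allows to be absorbed into the chart. -/

/-! ### Tangent maps and jets of diffeomorphisms -/

/-- The tangent map at `x` of a diffeomorphism `ψ` between open subsets of `ℝ³`, as an element of
`Gl(3, ℝ)`. -/
noncomputable def tangentUnit (ψ : OpenPartialHomeomorph E3 E3) (h : IsSmoothLocal ψ) (x : E3)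
    (hx : x ∈ ψ.source) : GL3 :=
  have h₁ : HasFDerivAt ψ (fderiv ℝ ψ x) x :=
    ((h.1.contDiffAt (ψ.open_source.mem_nhds hx)).differentiableAt (by simp)).hasFDerivAt
  have h₂ : HasFDerivAt ψ.symm (fderiv ℝ ψ.symm (ψ x)) (ψ x) :=
    ((h.2.contDiffAt (ψ.open_target.mem_nhds (ψ.map_source hx))).differentiableAt
      (by simp)).hasFDerivAt
  { val := fderiv ℝ ψ x
    inv := fderiv ℝ ψ.symm (ψ x)
    val_inv := by
      have h₁' : HasFDerivAt ψ (fderiv ℝ ψ x) (ψ.symm (ψ x)) := by rwa [ψ.left_inv hx]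
      refine (h₁'.comp (ψ x) h₂).unique ((hasFDerivAt_id (ψ x)).congr_of_eventuallyEq ?_)
      filter_upwards [ψ.open_target.mem_nhds (ψ.map_source hx)] with z hz
      exact ψ.right_inv hz
    inv_val := by
      refine (h₂.comp x h₁).unique ((hasFDerivAt_id x).congr_of_eventuallyEq ?_)
      filter_upwards [ψ.open_source.mem_nhds hx] with z hz
      exact ψ.left_inv hz }

section Charts

variable {ψ : OpenPartialHomeomorph E3 E3} (h : IsSmoothLocal ψ) {x : E3} (hx : x ∈ ψ.source)

theorem hasFDerivAt_tangentUnit : HasFDerivAt ψ (tangentUnit ψ h x hx : End3) x :=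
  ((h.1.contDiffAt (ψ.open_source.mem_nhds hx)).differentiableAt (by simp)).hasFDerivAt

theorem hasFDerivAt_symm_tangentUnit :
    HasFDerivAt ψ.symm (((tangentUnit ψ h x hx)⁻¹ : GL3) : End3) (ψ x) :=
  ((h.2.contDiffAt (ψ.open_target.mem_nhds (ψ.map_source hx))).differentiableAt
    (by simp)).hasFDerivAt

theorem IsJet.unique {f : E3 → E3} {a b c : E3} {P Q : GL3} (hP : IsJet f a b P)
    (hQ : IsJet f a c Q) : P = Q :=
  Units.ext (hP.2.unique hQ.2)

/-- The jet at `0` of the translated inverse `κ⁻¹ ∘ τ_{κ(x)}` of a deformation. -/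
theorem isJet_symm_translate :
    IsJet (fun v => ψ.symm (v + ψ x)) 0 x (tangentUnit ψ h x hx)⁻¹ := by
  refine ⟨by simp [ψ.left_inv hx], ?_⟩
  have h₁ : HasFDerivAt (fun v : E3 => v + ψ x) (ContinuousLinearMap.id ℝ E3) 0 :=
    (hasFDerivAt_id (0 : E3)).add_const (ψ x)
  have h₂ := hasFDerivAt_symm_tangentUnit h hx
  -- The base point must have the form taken by the translation at `0` for the chain rule to apply.
  rw [← zero_add (ψ x)] at h₂
  exact h₂.comp (0 : E3) h₁

/-- The jet at `x` of the local diffeomorphism `κ⁻¹ ∘ τ_{κ(y) - κ(x)} ∘ κ`. -/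
theorem isJet_symm_translate_self {y : E3} (hy : y ∈ ψ.source) :
    IsJet (fun z => ψ.symm (ψ z + (ψ y - ψ x))) x y
      ((tangentUnit ψ h y hy)⁻¹ * tangentUnit ψ h x hx) := by
  refine ⟨by simp [ψ.left_inv hy], ?_⟩
  have h₁ : HasFDerivAt (fun z : E3 => ψ z + (ψ y - ψ x)) (tangentUnit ψ h x hx : End3) x :=
    (hasFDerivAt_tangentUnit h hx).add_const _
  have h₂ := hasFDerivAt_symm_tangentUnit h hy
  rw [← add_sub_cancel (ψ x) (ψ y)] at h₂
  exact h₂.comp x h₁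

/-- A diffeomorphism followed by a linear isomorphism. -/
noncomputable def linearPostcomp (ψ : OpenPartialHomeomorph E3 E3) (A : GL3) :
    OpenPartialHomeomorph E3 E3 :=
  ψ.transHomeomorph (ContinuousLinearEquiv.unitsEquiv ℝ E3 A).toHomeomorph

theorem IsSmoothLocal.linearPostcomp {ψ : OpenPartialHomeomorph E3 E3} (h : IsSmoothLocal ψ)
    (A : GL3) : IsSmoothLocal (linearPostcomp ψ A) := by
  constructor
  · exact (ContinuousLinearEquiv.unitsEquiv ℝ E3 A).contDiff.comp_contDiffOn h.1
  · exact h.2.comp (ContinuousLinearEquiv.unitsEquiv ℝ E3 A).symm.contDiff.contDiffOn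
      (fun _ hz => hz)

theorem tangentUnit_linearPostcomp (A : GL3) :
    tangentUnit (linearPostcomp ψ A) (h.linearPostcomp A) x hx = A * tangentUnit ψ h x hx := by
  refine Units.ext ((hasFDerivAt_tangentUnit (h.linearPostcomp A) hx).unique ?_)
  exact (A : End3).hasFDerivAt.comp x (hasFDerivAt_tangentUnit h hx)

end Charts

/-! ### Flattening charts as group membership -/

theorem ContDiffOn.smoothOnSubset {X Y : Type*} [NormedAddCommGroup X] [NormedSpace ℝ X]
    [NormedAddCommGroup Y] [NormedSpace ℝ Y] {f : X → Y} {S U : Set X}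
    (hf : ContDiffOn ℝ ∞ f U) (hU : IsOpen U) (hS : S ⊆ U) : SmoothOnSubset f S :=
  fun _ hp => ⟨U, hU, hS hp, f, hf, fun _ _ => rfl⟩

theorem IsSmoothLocal.symm {ψ : OpenPartialHomeomorph E3 E3} (h : IsSmoothLocal ψ) :
    IsSmoothLocal ψ.symm :=
  ⟨h.2, by simpa using h.1⟩

theorem IsSmoothLocal.contDiffOn_fderiv {ψ : OpenPartialHomeomorph E3 E3} (h : IsSmoothLocal ψ) :
    ContDiffOn ℝ ∞ (fderiv ℝ ψ) ψ.source :=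
  h.1.fderiv_of_isOpen ψ.open_source (by simp)

theorem contDiffOn_frameChart {ψ : OpenPartialHomeomorph E3 E3} (h : IsSmoothLocal ψ) :
    ContDiffOn ℝ ∞ (frameChart ψ) (ψ.source ×ˢ Set.univ) := by
  have hm : Set.MapsTo Prod.fst (ψ.source ×ˢ (Set.univ : Set End3)) ψ.source := fun _ hq => hq.1
  exact (h.1.comp contDiffOn_fst hm).prodMk
    ((h.contDiffOn_fderiv.comp contDiffOn_fst hm).clm_comp contDiffOn_snd)

/-- A chart carries a set `R` of frames diffeomorphically onto a standard flat `G`-structure as soon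
as its fibres are the cosets of `G` given by the tangent map of the chart, and conversely. -/
theorem isDiffeoOn_frameChart_iff {φ : OpenPartialHomeomorph E3 E3} (h : IsSmoothLocal φ)
    (R : Set (E3 × GL3)) (G : Subgroup GL3) :
    IsDiffeoOn (frameChart φ) (framesOver R φ.source) (φ.target ×ˢ matrices G) ↔
      ∀ x (hx : x ∈ φ.source) Z, (x, Z) ∈ R ↔ tangentUnit φ h x hx * Z ∈ G := by
  constructor
  · rintro ⟨⟨hmaps, -, hsurj⟩, -⟩ x hx Z
    constructor
    · intro hZ
      obtain ⟨-, g, hg, hgZ⟩ := hmaps ⟨x, Z, hZ, hx, rfl⟩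
      have : g = tangentUnit φ h x hx * Z := Units.ext hgZ
      exact this ▸ hg
    · intro hg
      obtain ⟨_, ⟨x', Z', hR, hx', rfl⟩, hq⟩ :=
        hsurj (show (φ x, ((tangentUnit φ h x hx * Z : GL3) : End3)) ∈ φ.target ×ˢ matrices G from
          ⟨φ.map_source hx, _, hg, rfl⟩)
      -- Injectivity of the chart identifies the base points; only then can the linear parts be
      -- compared and cancelled.
      obtain rfl : x' = x := φ.injOn hx' hx (congrArg Prod.fst hq)
      have : tangentUnit φ h x' hx * Z' = tangentUnit φ h x' hx * Z :=
        Units.ext (congrArg Prod.snd hq)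
      rwa [mul_left_cancel this] at hR
  · intro H
    -- The inverse diffeomorphism is induced by the inverse chart, whose derivative is the inverse
    -- of `tangentUnit` by construction.
    have hleft : ∀ p ∈ framesOver R φ.source, frameChart φ.symm (frameChart φ p) = p := by
      rintro _ ⟨x, Z, -, hx, rfl⟩
      refine Prod.ext (φ.left_inv hx) ?_
      exact congrArg Units.val (inv_mul_cancel_left (tangentUnit φ h x hx) Z)
    refine ⟨⟨?_, ?_, ?_⟩, ?_, frameChart φ.symm, hleft, ?_⟩
    · rintro _ ⟨x, Z, hZ, hx, rfl⟩
      exact ⟨φ.map_source hx, _, (H x hx Z).1 hZ, rfl⟩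
    · exact fun p hp q hq hpq => by rw [← hleft p hp, hpq, hleft q hq]
    · rintro ⟨u, _⟩ ⟨hu, g, hg, rfl⟩
      have hx := φ.map_target hu
      refine ⟨(φ.symm u, (((tangentUnit φ h _ hx)⁻¹ * g : GL3) : End3)),
        ⟨_, _, (H _ hx _).2 (by simpa using hg), hx, rfl⟩, ?_⟩
      refine Prod.ext (φ.right_inv hu) ?_
      exact congrArg Units.val (mul_inv_cancel_left (tangentUnit φ h _ hx) g)
    · refine (contDiffOn_frameChart h).smoothOnSubset (φ.open_source.prod isOpen_univ) ?_
      rintro _ ⟨x, Z, -, hx, rfl⟩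
      exact ⟨hx, trivial⟩
    · exact (contDiffOn_frameChart h.symm).smoothOnSubset (φ.open_target.prod isOpen_univ)
        fun _ hq => ⟨hq.1, trivial⟩

theorem contDiffOn_jetChart {ψU ψV : OpenPartialHomeomorph E3 E3} (hU : IsSmoothLocal ψU)
    (hV : IsSmoothLocal ψV) :
    ContDiffOn ℝ ∞ (jetChart ψU ψV) (ψU.source ×ˢ ψV.source ×ˢ Set.univ) := by
  have h₁ : ContDiffOn ℝ ∞ (fun q : E3 × E3 × End3 => q.1)
    (ψU.source ×ˢ ψV.source ×ˢ Set.univ) := contDiff_fst.contDiffOn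
  have h₂ : ContDiffOn ℝ ∞ (fun q : E3 × E3 × End3 => q.2.1)
    (ψU.source ×ˢ ψV.source ×ˢ Set.univ) := (contDiff_fst.comp contDiff_snd).contDiffOn
  have h₃ : ContDiffOn ℝ ∞ (fun q : E3 × E3 × End3 => q.2.2)
    (ψU.source ×ˢ ψV.source ×ˢ Set.univ) := (contDiff_snd.comp contDiff_snd).contDiffOn
  have hm₁ : Set.MapsTo (fun q : E3 × E3 × End3 => q.1)
    (ψU.source ×ˢ ψV.source ×ˢ Set.univ) ψU.source := fun _ hq => hq.1
  have hm₂ : Set.MapsTo (fun q : E3 × E3 × End3 => q.2.1)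
    (ψU.source ×ˢ ψV.source ×ˢ Set.univ) ψV.source := fun _ hq => hq.2.1
  have hψ := hU.1.comp h₁ hm₁
  exact hψ.prodMk ((hV.1.comp h₂ hm₂).prodMk
    (((hV.contDiffOn_fderiv.comp h₂ hm₂).clm_comp h₃).clm_comp
      (hU.symm.contDiffOn_fderiv.comp hψ fun _ hq => ψU.map_source hq.1)))

/-- Two charts carry a set `Γ` of 1-jets diffeomorphically onto a standard flat groupoid as soon as
the 1-jets in `Γ` are those represented in the charts by elements of `G`, and conversely. -/
theorem isDiffeoOn_jetChart_iff {ψU ψV : OpenPartialHomeomorph E3 E3} (hU : IsSmoothLocal ψU)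
    (hV : IsSmoothLocal ψV) (Γ : Set (E3 × E3 × GL3)) (G : Subgroup GL3) :
    IsDiffeoOn (jetChart ψU ψV) (jetsOver Γ ψU.source ψV.source)
        (ψU.target ×ˢ ψV.target ×ˢ matrices G) ↔
      ∀ x (hx : x ∈ ψU.source) y (hy : y ∈ ψV.source) P, (x, y, P) ∈ Γ ↔
        tangentUnit ψV hV y hy * P * (tangentUnit ψU hU x hx)⁻¹ ∈ G := by
  constructor
  · rintro ⟨⟨hmaps, -, hsurj⟩, -⟩ x hx y hy P
    constructor
    · intro hP
      obtain ⟨-, -, g, hg, hgP⟩ := hmaps ⟨x, y, P, hP, hx, hy, rfl⟩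
      have : g = tangentUnit ψV hV y hy * P * (tangentUnit ψU hU x hx)⁻¹ := Units.ext hgP
      exact this ▸ hg
    · intro hg
      obtain ⟨_, ⟨x', y', P', hΓ, hx', hy', rfl⟩, hq⟩ :=
        hsurj (show (ψU x, ψV y, ((tangentUnit ψV hV y hy * P *
            (tangentUnit ψU hU x hx)⁻¹ : GL3) : End3)) ∈ ψU.target ×ˢ ψV.target ×ˢ matrices G from
          ⟨ψU.map_source hx, ψV.map_source hy, _, hg, rfl⟩)
      obtain rfl : x' = x := ψU.injOn hx' hx (congrArg Prod.fst hq)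
      obtain rfl : y' = y := ψV.injOn hy' hy (congrArg (fun q => q.2.1) hq)
      have : tangentUnit ψV hV y' hy * P' * (tangentUnit ψU hU x' hx)⁻¹ =
          tangentUnit ψV hV y' hy * P * (tangentUnit ψU hU x' hx)⁻¹ :=
        Units.ext (congrArg (fun q => q.2.2) hq)
      rwa [mul_left_cancel (mul_right_cancel this)] at hΓ
  · intro H
    have hcancel : ∀ A P B : GL3, A⁻¹ * (A * P * B⁻¹) * B = P := fun A P B => by group
    have hcancel' : ∀ A P B : GL3, A * (A⁻¹ * P * B) * B⁻¹ = P := fun A P B => by group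
    have hleft : ∀ p ∈ jetsOver Γ ψU.source ψV.source,
        jetChart ψU.symm ψV.symm (jetChart ψU ψV p) = p := by
      rintro _ ⟨x, y, P, -, hx, hy, rfl⟩
      refine Prod.ext (ψU.left_inv hx) (Prod.ext (ψV.left_inv hy) ?_)
      have := congrArg Units.val (hcancel (tangentUnit ψV hV y hy) P (tangentUnit ψU hU x hx))
      simp only [jetChart, OpenPartialHomeomorph.symm_symm, ψU.left_inv hx]
      exact this
    refine ⟨⟨?_, ?_, ?_⟩, ?_, jetChart ψU.symm ψV.symm, hleft, ?_⟩
    · rintro _ ⟨x, y, P, hP, hx, hy, rfl⟩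
      exact ⟨ψU.map_source hx, ψV.map_source hy, _, (H x hx y hy P).1 hP, rfl⟩
    · exact fun p hp q hq hpq => by rw [← hleft p hp, hpq, hleft q hq]
    · rintro ⟨u, v, _⟩ ⟨hu, hv, g, hg, rfl⟩
      have hx := ψU.map_target hu
      have hy := ψV.map_target hv
      refine ⟨(ψU.symm u, ψV.symm v,
          (((tangentUnit ψV hV _ hy)⁻¹ * g * tangentUnit ψU hU _ hx : GL3) : End3)),
        ⟨_, _, _, (H _ hx _ hy _).2 (by rwa [hcancel']), hx, hy, rfl⟩, ?_⟩
      refine Prod.ext (ψU.right_inv hu) (Prod.ext (ψV.right_inv hv) ?_)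
      exact congrArg Units.val (hcancel' (tangentUnit ψV hV _ hy) g (tangentUnit ψU hU _ hx))
    · refine (contDiffOn_jetChart hU hV).smoothOnSubset
        (ψU.open_source.prod (ψV.open_source.prod isOpen_univ)) ?_
      rintro _ ⟨x, y, P, -, hx, hy, rfl⟩
      exact ⟨hx, hy, trivial⟩
    · exact (contDiffOn_jetChart hU.symm hV.symm).smoothOnSubset
        (ψU.open_target.prod (ψV.open_target.prod isOpen_univ)) fun _ hq => ⟨hq.1, hq.2.1, trivial⟩

/-! ### Algebra of the material groupoid and of its frames -/

namespace ElasticBody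

variable {V : Type*} [NormedAddCommGroup V] [NormedSpace ℝ V] {𝓑 : ElasticBody V}

theorem materialGroupoid_mul {x y z : E3} {P Q : GL3} (hQ : (y, z, Q) ∈ 𝓑.materialGroupoid)
    (hP : (x, y, P) ∈ 𝓑.materialGroupoid) : (x, z, Q * P) ∈ 𝓑.materialGroupoid :=
  ⟨hP.1, hQ.2.1, fun F => by
    rw [← mul_assoc]
    exact (hP.2.2 (F * Q)).trans (hQ.2.2 F)⟩

theorem materialGroupoid_inv {x y : E3} {P : GL3} (hP : (x, y, P) ∈ 𝓑.materialGroupoid) :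
    (y, x, P⁻¹) ∈ 𝓑.materialGroupoid :=
  ⟨hP.2.1, hP.1, fun F => by
    have h := hP.2.2 (F * P⁻¹)
    rw [inv_mul_cancel_right] at h
    exact h.symm⟩

theorem mem_symmetryGroup_iff {z : E3} (hz : z ∈ 𝓑.carrier) {P : GL3} :
    P ∈ 𝓑.symmetryGroup z ↔ (z, z, P) ∈ 𝓑.materialGroupoid :=
  ⟨fun h => ⟨hz, hz, h⟩, fun h => h.2.2⟩

theorem IsUniform.exists_mem (hu : 𝓑.IsUniform) {x y : E3} (hx : x ∈ 𝓑.carrier)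
    (hy : y ∈ 𝓑.carrier) : ∃ P, (x, y, P) ∈ 𝓑.materialGroupoid := by
  obtain ⟨-, -, -, -, -, P, -, hP⟩ := hu x hx y hy
  exact ⟨P, hx, hy, hP⟩

theorem mem_isotropyGroup_iff {z₀ : E3} (hz₀ : z₀ ∈ 𝓑.carrier) {Z₀ g : GL3} :
    g ∈ 𝓑.isotropyGroup z₀ Z₀ ↔ (z₀, z₀, Z₀ * g * Z₀⁻¹) ∈ 𝓑.materialGroupoid := by
  rw [← mem_symmetryGroup_iff hz₀]
  constructor
  · rintro ⟨P, hP, rfl⟩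
    have : Z₀ * (Z₀⁻¹ * P * Z₀) * Z₀⁻¹ = P := by group
    simpa [this] using hP
  · intro h
    refine ⟨_, h, ?_⟩
    simp [mul_assoc]

/-- The factor `g` is redundant: conjugated by `Z₀` it becomes a symmetry at `z₀`, which is absorbed
into `L`. -/
theorem mem_gStructure_iff {z₀ : E3} (hz₀ : z₀ ∈ 𝓑.carrier) {Z₀ Z : GL3} {x : E3} :
    (x, Z) ∈ 𝓑.gStructure z₀ Z₀ ↔ (z₀, x, Z * Z₀⁻¹) ∈ 𝓑.materialGroupoid := by
  constructor
  · rintro ⟨x', L, g, hL, hg, hq⟩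
    obtain ⟨rfl, rfl⟩ := Prod.mk.inj hq
    have := materialGroupoid_mul hL ((mem_isotropyGroup_iff hz₀).1 hg)
    simpa only [mul_assoc] using this
  · exact fun h => ⟨x, _, 1, h, one_mem _, by simp⟩

/-- The fibre of `ω_{G₀}(B)` through one of its frames is a coset of `G₀`. -/
theorem mem_gStructure_iff_of_mem {z₀ : E3} (hz₀ : z₀ ∈ 𝓑.carrier) {Z₀ Z Z' : GL3} {x : E3}
    (hZ : (x, Z) ∈ 𝓑.gStructure z₀ Z₀) :
    (x, Z') ∈ 𝓑.gStructure z₀ Z₀ ↔ Z⁻¹ * Z' ∈ 𝓑.isotropyGroup z₀ Z₀ := by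
  rw [mem_gStructure_iff hz₀] at hZ ⊢
  rw [mem_isotropyGroup_iff hz₀]
  constructor
  · intro hZ'
    have := materialGroupoid_mul (materialGroupoid_inv hZ) hZ'
    have e : (Z * Z₀⁻¹)⁻¹ * (Z' * Z₀⁻¹) = Z₀ * (Z⁻¹ * Z') * Z₀⁻¹ := by group
    rwa [e] at this
  · intro hg
    have := materialGroupoid_mul hZ hg
    have e : Z * Z₀⁻¹ * (Z₀ * (Z⁻¹ * Z') * Z₀⁻¹) = Z' * Z₀⁻¹ := by group
    rwa [e] at this

/-- Composition with `X` shows that `P` is material iff `P * X` is again a frame of the structure,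
and the fibre over `y` is the coset `Y * G₀`. -/
theorem mem_materialGroupoid_iff_of_mem {z₀ : E3} (hz₀ : z₀ ∈ 𝓑.carrier) {Z₀ X Y P : GL3}
    {x y : E3} (hX : (x, X) ∈ 𝓑.gStructure z₀ Z₀) (hY : (y, Y) ∈ 𝓑.gStructure z₀ Z₀) :
    (x, y, P) ∈ 𝓑.materialGroupoid ↔ Y⁻¹ * P * X ∈ 𝓑.isotropyGroup z₀ Z₀ := by
  rw [mul_assoc, ← mem_gStructure_iff_of_mem hz₀ hY]
  rw [mem_gStructure_iff hz₀] at hX ⊢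
  constructor
  · intro hP
    have := materialGroupoid_mul hP hX
    rwa [← mul_assoc] at this
  · intro h
    have := materialGroupoid_mul h (materialGroupoid_inv hX)
    have e : P * X * Z₀⁻¹ * (X * Z₀⁻¹)⁻¹ = P := by group
    rwa [e] at this

/-- Each `F` imposes an equation between values of the continuous map `W (·) z`, so the group is an
intersection of closed sets. -/
theorem isClosed_symmetryGroup {z : E3} (hz : z ∈ 𝓑.carrier) :
    IsClosed (𝓑.symmetryGroup z : Set GL3) := by
  have hW : Continuous fun F : GL3 => 𝓑.W (F : End3) z :=
    𝓑.smooth_W.continuousOn.comp_continuous (Units.continuous_val.prodMk continuous_const)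
      fun F => ⟨F.isUnit, hz⟩
  have : (𝓑.symmetryGroup z : Set GL3) =
      ⋂ F : GL3, {P : GL3 | 𝓑.W ((F * P : GL3) : End3) z = 𝓑.W (F : End3) z} := by
    ext P
    simp only [Set.mem_iInter]
    rfl
  rw [this]
  exact isClosed_iInter fun F =>
    isClosed_eq (hW.comp (continuous_const.mul continuous_id)) continuous_const

theorem isClosed_isotropyGroup {z₀ : E3} (hz₀ : z₀ ∈ 𝓑.carrier) (Z₀ : GL3) :
    IsClosed (𝓑.isotropyGroup z₀ Z₀ : Set GL3) := by
  have : (𝓑.isotropyGroup z₀ Z₀ : Set GL3) =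
      (fun g => Z₀ * g * Z₀⁻¹) ⁻¹' (𝓑.symmetryGroup z₀ : Set GL3) := by
    ext g
    exact (mem_isotropyGroup_iff hz₀).trans (mem_symmetryGroup_iff hz₀).symm
  rw [this]
  exact (isClosed_symmetryGroup hz₀).preimage
    ((continuous_const.mul continuous_id).mul continuous_const)

theorem IsSectionFamily.mem_gStructure_iff {ι : Type*} {z₀ : E3} (hz₀ : z₀ ∈ 𝓑.carrier)
    {U : ι → Set E3} {σ : ι → E3 → GL3} (h : 𝓑.IsSectionFamily z₀ U σ) (Z₀ : GL3) {a : ι} {x : E3}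
    (hx : x ∈ U a) (Z : GL3) :
    (x, Z) ∈ 𝓑.gStructure z₀ Z₀ ↔ ∃ g ∈ 𝓑.isotropyGroup z₀ Z₀, Z = σ a x * Z₀ * g := by
  have hσ : (x, σ a x * Z₀) ∈ 𝓑.gStructure z₀ Z₀ :=
    ⟨x, σ a x, 1, h.mem a x hx, one_mem _, by simp⟩
  rw [mem_gStructure_iff_of_mem hz₀ hσ]
  constructor
  · exact fun hg => ⟨_, hg, by group⟩
  · rintro ⟨g, hg, rfl⟩
    rwa [inv_mul_cancel_left]

theorem IsSectionFamily.isGStructure {ι : Type*} {z₀ : E3} (hz₀ : z₀ ∈ 𝓑.carrier)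
    {U : ι → Set E3} {σ : ι → E3 → GL3} (h : 𝓑.IsSectionFamily z₀ U σ) (Z₀ : GL3) :
    IsGStructure 𝓑.carrier (𝓑.isotropyGroup z₀ Z₀) (𝓑.gStructure z₀ Z₀) where
  isClosed := isClosed_isotropyGroup hz₀ Z₀
  base _ _ hZ := ((ElasticBody.mem_gStructure_iff hz₀).1 hZ).2.1
  locally_trivial x hx := by
    rw [← h.cover] at hx
    obtain ⟨a, ha⟩ := Set.mem_iUnion.1 hx
    refine ⟨U a, h.isOpen a, ha, h.cover ▸ Set.subset_iUnion U a, fun y => σ a y * Z₀, ?_,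
      fun y hy Z => h.mem_gStructure_iff hz₀ Z₀ hy Z⟩
    exact (h.smooth a).clm_comp contDiffOn_const

theorem frameQuotients_gStructure (hu : 𝓑.IsUniform) {z₀ : E3} (hz₀ : z₀ ∈ 𝓑.carrier) (Z₀ : GL3) :
    frameQuotients (𝓑.gStructure z₀ Z₀) = 𝓑.materialGroupoid := by
  ext q
  constructor
  · rintro ⟨x, y, X, Y, hX, hY, rfl⟩
    exact (mem_materialGroupoid_iff_of_mem hz₀ hX hY).2 (by simp)
  · obtain ⟨x, y, P⟩ := q
    intro hP
    obtain ⟨L, hL⟩ := hu.exists_mem hz₀ hP.1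
    -- Transporting the frame `L * Z₀` along `P` writes `P` as a quotient of two frames.
    refine ⟨x, y, L * Z₀, P * (L * Z₀), ⟨x, L, 1, hL, one_mem _, by simp⟩,
      ⟨y, P * L, 1, materialGroupoid_mul hP hL, one_mem _, by simp [mul_assoc]⟩, by simp [mul_assoc]⟩

/-! ### Homogeneity and integrability -/

/-- Uniqueness of the derivative makes the existential jet explicit through the chain rule. -/
theorem isHomogeneousOn_iff {U : Set E3} :
    𝓑.IsHomogeneousOn U ↔ ∃ (κ : OpenPartialHomeomorph E3 E3) (h : IsSmoothLocal κ),
      κ.source = U ∧ ∀ x (hx : x ∈ κ.source) y (hy : y ∈ κ.source),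
        (x, y, (tangentUnit κ h y hy)⁻¹ * tangentUnit κ h x hx) ∈ 𝓑.materialGroupoid := by
  constructor
  · rintro ⟨κ, h, rfl, H⟩
    refine ⟨κ, h, rfl, fun x hx y hy => ?_⟩
    obtain ⟨P, hP, hjet⟩ := H x hx y hy
    rwa [← hjet.unique (isJet_symm_translate_self h hx hy)]
  · rintro ⟨κ, h, rfl, H⟩
    exact ⟨κ, h, rfl, fun x hx y hy => ⟨_, H x hx y hy, isJet_symm_translate_self h hx hy⟩⟩

theorem isFrameHomogeneousOn_iff {z₀ : E3} {Z₀ : GL3} {U : Set E3} :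
    𝓑.IsFrameHomogeneousOn z₀ Z₀ U ↔
      ∃ (κ : OpenPartialHomeomorph E3 E3) (h : IsSmoothLocal κ),
        κ.source = U ∧ ∀ x (hx : x ∈ κ.source),
          (x, (tangentUnit κ h x hx)⁻¹) ∈ 𝓑.gStructure z₀ Z₀ := by
  constructor
  · rintro ⟨κ, h, rfl, H⟩
    refine ⟨κ, h, rfl, fun x hx => ?_⟩
    obtain ⟨Z, hZ, hjet⟩ := H x hx
    rwa [← hjet.unique (isJet_symm_translate h hx)]
  · rintro ⟨κ, h, rfl, H⟩
    exact ⟨κ, h, rfl, fun x hx => ⟨_, H x hx, isJet_symm_translate h hx⟩⟩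

theorem isHomogeneousOn_iff_isFrameHomogeneousOn (hu : 𝓑.IsUniform) {z₀ : E3}
    (hz₀ : z₀ ∈ 𝓑.carrier) (Z₀ : GL3) (U : Set E3) :
    𝓑.IsHomogeneousOn U ↔ 𝓑.IsFrameHomogeneousOn z₀ Z₀ U := by
  rw [isHomogeneousOn_iff, isFrameHomogeneousOn_iff]
  constructor
  · rintro ⟨κ, h, rfl, H⟩
    rcases κ.source.eq_empty_or_nonempty with hempty | ⟨y, hy⟩
    · exact ⟨κ, h, rfl, fun x hx => absurd hx (by simp [hempty])⟩
    obtain ⟨L, hL⟩ := hu.exists_mem hz₀ (H y hy y hy).1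
    -- The linear factor is chosen so that the inverse tangent map of the new chart at `y` is the
    -- frame `L * Z₀`; material jets from `y` then carry it to every `x`.
    refine ⟨linearPostcomp κ (tangentUnit κ h y hy * L * Z₀)⁻¹, h.linearPostcomp _, rfl,
      fun x hx => ?_⟩
    rw [tangentUnit_linearPostcomp h hx, mem_gStructure_iff hz₀]
    have := materialGroupoid_mul (materialGroupoid_inv (H x hx y hy)) hL
    convert this using 3
    group
  · rintro ⟨κ, h, rfl, H⟩
    refine ⟨κ, h, rfl, fun x hx y hy => ?_⟩
    rw [mem_materialGroupoid_iff_of_mem hz₀ (H x hx) (H y hy)]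
    simp

theorem isLocallyHomogeneous_iff_isFrameLocallyHomogeneous (hu : 𝓑.IsUniform) {z₀ : E3}
    (hz₀ : z₀ ∈ 𝓑.carrier) (Z₀ : GL3) :
    𝓑.IsLocallyHomogeneous ↔ 𝓑.IsFrameLocallyHomogeneous z₀ Z₀ := by
  simp only [IsLocallyHomogeneous, IsFrameLocallyHomogeneous,
    isHomogeneousOn_iff_isFrameHomogeneousOn hu hz₀ Z₀]

/-- The condition that a chart flattens `ω_{G₀}(B)` says that its inverse tangent maps belong to
`ω_{G₀}(B)`. -/
theorem isDiffeoOn_frameChart_gStructure_iff {z₀ : E3} (hz₀ : z₀ ∈ 𝓑.carrier) {Z₀ : GL3}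
    {φ : OpenPartialHomeomorph E3 E3} (h : IsSmoothLocal φ) :
    IsDiffeoOn (frameChart φ) (framesOver (𝓑.gStructure z₀ Z₀) φ.source)
        (φ.target ×ˢ matrices (𝓑.isotropyGroup z₀ Z₀)) ↔
      ∀ x (hx : x ∈ φ.source), (x, (tangentUnit φ h x hx)⁻¹) ∈ 𝓑.gStructure z₀ Z₀ := by
  rw [isDiffeoOn_frameChart_iff h]
  constructor
  · exact fun H x hx => (H x hx _).2 (by simp)
  · intro H x hx Z
    rw [mem_gStructure_iff_of_mem hz₀ (H x hx), inv_inv]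

theorem isFrameLocallyHomogeneous_iff_isIntegrableGStructure {z₀ : E3} (hz₀ : z₀ ∈ 𝓑.carrier)
    (Z₀ : GL3) :
    𝓑.IsFrameLocallyHomogeneous z₀ Z₀ ↔
      IsIntegrableGStructure 𝓑.carrier (𝓑.isotropyGroup z₀ Z₀) (𝓑.gStructure z₀ Z₀) := by
  refine forall₂_congr fun x _ => ?_
  constructor
  · rintro ⟨U, -, hUB, hxU, hU⟩
    obtain ⟨κ, h, rfl, H⟩ := isFrameHomogeneousOn_iff.1 hU
    exact ⟨κ, h, hUB, hxU, (isDiffeoOn_frameChart_gStructure_iff hz₀ h).2 H⟩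
  · rintro ⟨φ, h, hφB, hxφ, H⟩
    exact ⟨φ.source, φ.open_source, hφB, hxφ, isFrameHomogeneousOn_iff.2
      ⟨φ, h, rfl, (isDiffeoOn_frameChart_gStructure_iff hz₀ h).1 H⟩⟩

theorem isIntegrableGStructure_iff_isIntegrableGroupoid (hu : 𝓑.IsUniform) {z₀ : E3}
    (hz₀ : z₀ ∈ 𝓑.carrier) (Z₀ : GL3) :
    IsIntegrableGStructure 𝓑.carrier (𝓑.isotropyGroup z₀ Z₀) (𝓑.gStructure z₀ Z₀) ↔
      IsIntegrableGroupoid 𝓑.carrier 𝓑.materialGroupoid := by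
  constructor
  · intro H
    refine ⟨𝓑.isotropyGroup z₀ Z₀, isClosed_isotropyGroup hz₀ Z₀, fun x hx y hy => ?_⟩
    obtain ⟨ψU, hU, hUB, hxU, HU⟩ := H x hx
    obtain ⟨ψV, hV, hVB, hyV, HV⟩ := H y hy
    rw [isDiffeoOn_frameChart_gStructure_iff hz₀ hU] at HU
    rw [isDiffeoOn_frameChart_gStructure_iff hz₀ hV] at HV
    refine ⟨ψU, ψV, hU, hUB, hxU, hV, hVB, hyV, (isDiffeoOn_jetChart_iff hU hV _ _).2 ?_⟩
    intro a ha b hb P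
    rw [mem_materialGroupoid_iff_of_mem hz₀ (HU a ha) (HV b hb), inv_inv]
  · rintro ⟨G, -, H⟩
    -- The given `G` need not be `G₀`, as it depends on the charts; groupoid homogeneity mentions no
    -- group and avoids the comparison.
    rw [← isFrameLocallyHomogeneous_iff_isIntegrableGStructure hz₀,
      ← isLocallyHomogeneous_iff_isFrameLocallyHomogeneous hu hz₀]
    intro x hx
    obtain ⟨ψU, ψV, hU, hUB, hxU, hV, -, hxV, HUV⟩ := H x hx x hx
    rw [isDiffeoOn_jetChart_iff hU hV] at HUV
    refine ⟨ψU.source, ψU.open_source, hUB, hxU, isHomogeneousOn_iff.2 ⟨ψU, hU, rfl, ?_⟩⟩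
    -- the elements of `G` represent, in the charts, 1-jets with target `x`
    have key : ∀ a (ha : a ∈ ψU.source),
        (a, x, (tangentUnit ψV hV x hxV)⁻¹ * tangentUnit ψU hU a ha) ∈ 𝓑.materialGroupoid :=
      fun a ha => (HUV a ha x hxV _).2 (by simp)
    -- Factoring the jet from `a` to `b` through `x` cancels the tangent map of `ψV`, leaving only
    -- the chart `ψU`.
    intro a ha b hb
    have := materialGroupoid_mul (materialGroupoid_inv (key b hb)) (key a ha)
    convert this using 3
    group

end ElasticBody

theorem mainTheorem5 {V : Type*} [NormedAddCommGroup V] [NormedSpace ℝ V]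
    (𝓑 : ElasticBody V) (huniform : 𝓑.IsUniform)
    (z₀ : E3) (hz₀ : z₀ ∈ 𝓑.carrier) (Z₀ : GL3) :
    -- smooth local sections of `Ω_{z₀}(B)` turn `ω_{G₀}(B)` into the `G₀`-structure with the
    -- local sections `σ_a · Z₀`
    (∀ {ι : Type*} (U : ι → Set E3) (σ : ι → E3 → GL3), 𝓑.IsSectionFamily z₀ U σ →
      IsGStructure 𝓑.carrier (𝓑.isotropyGroup z₀ Z₀) (𝓑.gStructure z₀ Z₀) ∧
      ∀ a, ∀ x ∈ U a, ∀ Z, (x, Z) ∈ 𝓑.gStructure z₀ Z₀ ↔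
        ∃ g ∈ 𝓑.isotropyGroup z₀ Z₀, Z = σ a x * Z₀ * g) ∧
    -- `𝒢 (ω_{G₀}(B)) = Ω(B)`
    frameQuotients (𝓑.gStructure z₀ Z₀) = 𝓑.materialGroupoid ∧
    -- equivalence of the two notions of integrability
    (IsIntegrableGStructure 𝓑.carrier (𝓑.isotropyGroup z₀ Z₀) (𝓑.gStructure z₀ Z₀) ↔
      IsIntegrableGroupoid 𝓑.carrier 𝓑.materialGroupoid) ∧
    -- equivalence of the two notions of homogeneity and of local homogeneity
    (𝓑.IsHomogeneous ↔ 𝓑.IsFrameHomogeneous z₀ Z₀) ∧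
    (𝓑.IsLocallyHomogeneous ↔ 𝓑.IsFrameLocallyHomogeneous z₀ Z₀) ∧
    -- local homogeneity is integrability
    (𝓑.IsLocallyHomogeneous ↔ IsIntegrableGroupoid 𝓑.carrier 𝓑.materialGroupoid) := by
  exact ⟨fun U σ h => ⟨h.isGStructure hz₀ Z₀, fun a x hx Z => h.mem_gStructure_iff hz₀ Z₀ hx Z⟩,
    ElasticBody.frameQuotients_gStructure huniform hz₀ Z₀,
    ElasticBody.isIntegrableGStructure_iff_isIntegrableGroupoid huniform hz₀ Z₀,
    ElasticBody.isHomogeneousOn_iff_isFrameHomogeneousOn huniform hz₀ Z₀ 𝓑.carrier,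
    ElasticBody.isLocallyHomogeneous_iff_isFrameLocallyHomogeneous huniform hz₀ Z₀,
    (ElasticBody.isLocallyHomogeneous_iff_isFrameLocallyHomogeneous huniform hz₀ Z₀).trans
      ((ElasticBody.isFrameLocallyHomogeneous_iff_isIntegrableGStructure hz₀ Z₀).trans
        (ElasticBody.isIntegrableGStructure_iff_isIntegrableGroupoid huniform hz₀ Z₀))⟩
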